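/- An upward-planar layered drawing of a directed graph maps its vertices to distinct points of the plane with integer $y$-coordinates and each edge to a curve from its tail to its head along which the $y$-coordinate strictly increases, such that curves of distinct edges meet only at common endpoints and no curve passes through a vertex that is not one of its endpoints. The span of an edge in a drawing is the $y$-coordinate of its head minus the $y$-coordinate of its tail, the span of a drawing is the maximum span of its edges, and the span of a graph is the minimum span of its upward-planar layered drawings. A directed tree is a directed graph whose underlying undirected graph is a tree; the degree of a vertex is the number of its incident (incoming or outgoing) edges. For $m \ge 1$ let $T'_m$ be the following rooted tree: $T'_1$ is a single edge, $T'_2$ is a path of length two rooted at its middle vertex, and for $m>2$ the root of $T'_m$ has $m$ children, each of which is the root of a copy of $T'_{m-2}$ if $m$ is odd and of $T'_{m-3}$ if $m$ is even. Let $T_m$ be either of the two orientations of $T'_m$ in which every vertex is a source or a sink. For every integer $d>2$ and every integer $\ell\ge 1$ there is a finite directed tree of maximum degree exactly $d$ (so each vertex has degree at most $d$) whose directed paths all have length at most $\ell$, which has an upward-planar layered drawing, and whose span is at least $$\frac{(d-1)^{\ell}}{2\ell}.$$ Such a tree is obtained from $T_{(d-1)^{\ell}}$ by replacing each vertex $v$,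 together with the edges from or to its children, by a perfect $(d-1)$-ary tree of height $\ell$ rooted at $v$, all of whose edges are directed from the root to the leaves if $v$ is a source of $T_{(d-1)^\ell}$ and from the leaves to the root if $v$ is a sink, and merging the children of $v$, from left to right, with the leftmost leaves of this perfect tree. -/

import Mathlib

/-! ### Directed graphs, directed trees, degrees and directed paths -/

namespace Digraph

variable {V : Type*}

/-- A directed tree: a directed graph without loops and without pairs of opposite arcs whose
underlying undirected graph is a tree. -/
def IsDirectedTree (G : Digraph V) : Prop :=
  (∀ u v, G.Adj u v → ¬ G.Adj v u) ∧ G.toSimpleGraphInclusive.IsTree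

/-- The degree of a vertex: the number of its incident (incoming or outgoing) arcs. -/
noncomputable def vertexDegree (G : Digraph V) (v : V) : ℕ :=
  {e : V × V | G.Adj e.1 e.2 ∧ (e.1 = v ∨ e.2 = v)}.ncard

/-- `p 0, p 1, …, p m` is a directed path of length `m`. -/
def IsDirectedPath (G : Digraph V) {m : ℕ} (p : Fin (m + 1) → V) : Prop :=
  Function.Injective p ∧ ∀ i : Fin m, G.Adj (p i.castSucc) (p i.succ)

end Digraph

/-! ### Upward-planar layered drawings and the span -/

/-- An upward-planar layered drawing of a directed graph. The vertex `v` is drawn at the point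
`(x v, layer v)`, an arc from `u` to `v` is drawn as a curve from the point of `u` to the point
of `v` along which the `y`-coordinate strictly increases. -/
structure UpwardPlanarLayeredDrawing {V : Type*} (G : Digraph V) where
  x : V → ℝ
  layer : V → ℤ
  /-- Distinct vertices are drawn at distinct points. -/
  point_injective : Function.Injective fun v => ((x v, (layer v : ℝ)) : ℝ × ℝ)
  curve : ∀ {u v : V}, G.Adj u v →
    Path ((x u, (layer u : ℝ)) : ℝ × ℝ) ((x v, (layer v : ℝ)) : ℝ × ℝ)
  upward : ∀ {u v : V} (h : G.Adj u v), StrictMono fun t => (curve h t).2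
  /-- Curves of different arcs meet only at common endpoints. -/
  noncrossing : ∀ {u v u' v' : V} (h : G.Adj u v) (h' : G.Adj u' v'), (u, v) ≠ (u', v') →
    ∀ s t, curve h s = curve h' t →
      ∃ w, (w = u ∨ w = v) ∧ (w = u' ∨ w = v') ∧ curve h s = (x w, (layer w : ℝ))
  /-- The curve of an arc passes through no vertex but its endpoints. -/
  avoids_vertices : ∀ {u v : V} (h : G.Adj u v) (w : V) (t),
    curve h t = (x w, (layer w : ℝ)) → w = u ∨ w = v

/-- The span of a drawing: the maximum, over all arcs, of the `y`-coordinate of the head minus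
the `y`-coordinate of the tail (which is positive since arcs are drawn upward). -/
noncomputable def UpwardPlanarLayeredDrawing.span {V : Type*} {G : Digraph V}
    (Γ : UpwardPlanarLayeredDrawing G) : ℕ∞ :=
  ⨆ (u : V) (v : V) (_ : G.Adj u v), (((Γ.layer v - Γ.layer u).toNat : ℕ) : ℕ∞)

/-- The span of a directed graph: the minimum span of its upward-planar layered drawings
(and `⊤` if it has no such drawing). -/
noncomputable def Digraph.span {V : Type*} (G : Digraph V) : ℕ∞ :=
  ⨅ Γ : UpwardPlanarLayeredDrawing G, Γ.span

/-! ### Rooted trees with oriented edges -/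

/-- Finite rooted trees with oriented edges: `node out n c` has a root with `n` children, which
are the roots of the subtrees `c 0, …, c (n - 1)`. The edges between the root and its children
all leave the root if `out = true`, and all enter the root if `out = false`. -/
inductive OTree : Type where
  | node (out : Bool) (n : ℕ) (c : Fin n → OTree) : OTree

namespace OTree

/-- The tree with a single vertex. -/
def single (out : Bool) : OTree := node out 0 Fin.elim0

/-- The vertices of a rooted tree. -/
inductive Vertex : OTree → Type where
  | root {t : OTree} : Vertex t
  | child {out : Bool} {n : ℕ} {c : Fin n → OTree} (i : Fin n) (v : Vertex (c i)) :
      Vertex (node out n c)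

/-- `Arc t u v`: the tree `t` has an edge with tail `u` and head `v`. -/
inductive Arc : (t : OTree) → Vertex t → Vertex t → Prop where
  | away {n : ℕ} {c : Fin n → OTree} (i : Fin n) :
      Arc (node true n c) .root (.child i .root)
  | toward {n : ℕ} {c : Fin n → OTree} (i : Fin n) :
      Arc (node false n c) (.child i .root) .root
  | lift {out : Bool} {n : ℕ} {c : Fin n → OTree} {i : Fin n} {u v : Vertex (c i)} :
      Arc (c i) u v → Arc (node out n c) (.child i u) (.child i v)

/-- The directed graph given by a rooted tree with oriented edges. -/
def toDigraph (t : OTree) : Digraph (Vertex t) where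
  Adj := Arc t

instance finite_vertex (t : OTree) : Finite (Vertex t) := by
  induction t with
  | node out n c ih =>
    refine Finite.of_surjective
      (fun o : Option (Σ i : Fin n, Vertex (c i)) =>
        (o.elim Vertex.root fun p => Vertex.child p.1 p.2 : Vertex (node out n c))) ?_
    intro v
    cases v with
    | root => exact ⟨none, rfl⟩
    | child i v => exact ⟨some ⟨i, v⟩, rfl⟩

/-- The tree `T_d` (for `d ≥ 1`): `T_1` is a single edge, `T_2` is a path of length two rooted at
its middle vertex, and for `d > 2` the root has `d` children, each of which is the root of a copy
of the tree for `d - 2` if `d` is odd, and for `d - 3` if `d` is even. The edges are oriented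
such that every vertex is a source or a sink; the root is a source if and only if
`out = true`. -/
def alternating : (out : Bool) → (d : ℕ) → OTree
  | out, 0 => single out
  | out, 1 => node out 1 fun _ => single (!out)
  | out, 2 => node out 2 fun _ => single (!out)
  | out, n + 3 => node out (n + 3) fun _ =>
      if Odd (n + 3) then alternating (!out) (n + 1) else alternating (!out) n

/-- The perfect `k`-ary tree of height `h`, with all edges directed from the root to the leaves
(`out = true`) or from the leaves to the root (`out = false`), in which the `j`-th leaf
(counted from the left, `j = 0, …, k ^ h - 1`) is merged with the root of the tree `f j`. -/
def perfectWithLeaves (out : Bool) (k : ℕ) : (h : ℕ) → (f : ℕ → OTree) → OTree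
  | 0, f => f 0
  | h + 1, f => node out k fun a => perfectWithLeaves out k h fun j => f (a * k ^ h + j)

/-- Each vertex `v`, together with the edges to its children, is replaced by a perfect `k`-ary
tree of height `h`. Its edges are directed from the root to the leaves if the flag `out` of `v` is
`true` (for the trees `alternating`: if `v` is a source), and from the leaves to the root otherwise
(if `v` is a sink). The children of `v` are merged with
distinct leaves (this needs that `v` has at most `k ^ h` children); the other leaves remain
leaves. -/
def replaceVertices (k h : ℕ) : OTree → OTree
  | node out n c => perfectWithLeaves out k h fun j =>
      if hj : j < n then replaceVertices k h (c ⟨j, hj⟩) else single out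

end OTree

/-! ### Vertical profiles of drawings -/

namespace UpwardPlanarLayeredDrawing

open Set

variable {V : Type*} {G : Digraph V} (Γ : UpwardPlanarLayeredDrawing G)

/-! Fix a drawing in which every arc has span at most `s`, and write `k = d - 1`, `h = ℓ`. By strong
induction on `m ≤ k ^ h`, every embedded copy of the tree built from `alternating out m` contains a
`y`-monotone curve that starts at the root, goes up if the root is a source and down if it is a
sink, and covers a height of at least `m / 2` and at most `h * s` (`exists_link_le_heightOver`). For
`m = k ^ h` this is the bound.

The curve ends at a leaf of the perfect tree at the root; it consists of `h` arcs, whence `h * s`.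
For the lower estimate, suppose that all `m` leaves with attached trees are closer than `m / 2`.
Fewer than `m / 2` layers are available, so three of these leaves share a layer. By induction the
tree at the middle one contains a monotone curve back to the layer of the root. It is enclosed by
the curves from the root to the outer two leaves, so the intermediate value theorem yields a
forbidden crossing (`Link.layer_notMem_of_between`, `exists_leaf_le_heightOver`).

Directed paths are short because of a rank function with values in `0, …, h` that grows by one along
arcs (`Alternates.hasRank`). The span is finite because of an explicit straight-line drawing
(`drawing`): columns by depth, subtrees in disjoint horizontal strips. -/

/-- The part of the drawing that is spanned by the vertices in `S`. -/
def support (S : Set V) : Set (ℝ × ℝ) :=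
  {p | (∃ w ∈ S, p = (Γ.x w, (Γ.layer w : ℝ))) ∨
    ∃ (a b : V) (h : G.Adj a b) (t : unitInterval), a ∈ S ∧ b ∈ S ∧ Γ.curve h t = p}

/-- The vertices `u` and `v` are linked in `S` if the part of the drawing spanned by `S` contains
a `y`-monotone curve (the graph of a continuous function of `y`) between them. -/
def Link (S : Set V) (u v : V) : Prop :=
  ∃ g : ℝ → ℝ, Continuous g ∧ g (Γ.layer u) = Γ.x u ∧ g (Γ.layer v) = Γ.x v ∧
    ∀ y ∈ uIcc (Γ.layer u : ℝ) (Γ.layer v), (g y, y) ∈ Γ.support S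

variable {Γ}

theorem support_mono {S S' : Set V} (h : S ⊆ S') : Γ.support S ⊆ Γ.support S' := by
  rintro p (⟨w, hw, hp⟩ | ⟨a, b, hab, t, ha, hb, hp⟩)
  · exact Or.inl ⟨w, h hw, hp⟩
  · exact Or.inr ⟨a, b, hab, t, h ha, h hb, hp⟩

/-- The drawing axioms make every common point of the two supports a vertex that belongs to both
sets. -/
theorem disjoint_support {S S' : Set V} (h : Disjoint S S') :
    Disjoint (Γ.support S) (Γ.support S') := by
  have key : ∀ w, w ∈ S → w ∈ S' → False := fun w hw hw' => Set.disjoint_left.1 h hw hw'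
  rw [Set.disjoint_left]
  rintro p (⟨w, hw, hp⟩ | ⟨a, b, hab, t, ha, hb, hp⟩) (⟨w', hw', hp'⟩ | ⟨a', b', hab', t', ha', hb', hp'⟩)
  · exact key w hw (Γ.point_injective (hp.symm.trans hp') ▸ hw')
  · rcases Γ.avoids_vertices hab' w t' (hp'.trans hp) with rfl | rfl
    exacts [key _ hw ha', key _ hw hb']
  · rcases Γ.avoids_vertices hab w' t (hp.trans hp') with rfl | rfl
    exacts [key _ ha hw', key _ hb hw']
  · have hne : (a, b) ≠ (a', b') := by
      rintro ⟨⟩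
      exact key _ ha ha'
    obtain ⟨w, h1, h2, -⟩ := Γ.noncrossing hab hab' hne t t' (hp.trans hp'.symm)
    have hwS : w ∈ S := by rcases h1 with rfl | rfl <;> assumption
    have hwS' : w ∈ S' := by rcases h2 with rfl | rfl <;> assumption
    exact key w hwS hwS'

theorem layer_lt_of_adj (Γ : UpwardPlanarLayeredDrawing G) {u v : V} (h : G.Adj u v) :
    Γ.layer u < Γ.layer v := by
  have := Γ.upward h (show (0 : unitInterval) < 1 from zero_lt_one)
  simpa using this

theorem Link.mono {S S' : Set V} (h : S ⊆ S') {u v : V} : Γ.Link S u v → Γ.Link S' u v := by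
  rintro ⟨g, hg, hu, hv, hS⟩
  exact ⟨g, hg, hu, hv, fun y hy => support_mono h (hS y hy)⟩

theorem Link.symm {S : Set V} {u v : V} : Γ.Link S u v → Γ.Link S v u := by
  rintro ⟨g, hg, hu, hv, hS⟩
  exact ⟨g, hg, hv, hu, fun y hy => hS y (uIcc_comm _ (_ : ℝ) ▸ hy)⟩

theorem Link.refl {S : Set V} {u : V} (hu : u ∈ S) : Γ.Link S u u := by
  refine ⟨fun _ => Γ.x u, continuous_const, rfl, rfl, fun y hy => Or.inl ⟨u, hu, ?_⟩⟩
  rw [uIcc_self, mem_singleton_iff] at hy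
  rw [hy]

/-- The order assumptions make the two `y`-ranges adjacent, so the glued curve is still the graph of
a function of `y`. -/
theorem Link.trans {S : Set V} {u v w : V} (huv : Γ.Link S u v) (hvw : Γ.Link S v w)
    (h1 : Γ.layer u ≤ Γ.layer v) (h2 : Γ.layer v ≤ Γ.layer w) : Γ.Link S u w := by
  obtain ⟨g, hg, hgu, hgv, hS⟩ := huv
  obtain ⟨g', hg', hgv', hgw', hS'⟩ := hvw
  have h1' : (Γ.layer u : ℝ) ≤ Γ.layer v := by exact_mod_cast h1
  have h2' : (Γ.layer v : ℝ) ≤ Γ.layer w := by exact_mod_cast h2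
  rw [uIcc_of_le h1'] at hS
  rw [uIcc_of_le h2'] at hS'
  refine ⟨fun y => if y ≤ Γ.layer v then g y else g' y, ?_, ?_, ?_, ?_⟩
  · refine hg.if_le hg' continuous_id continuous_const ?_
    rintro y rfl
    exact hgv.trans hgv'.symm
  · simp [h1', hgu]
  · rcases h2'.eq_or_lt with h | h
    · simp only [← h, le_refl, if_true, hgv]
      rw [← hgv', h, hgw']
    · simp [not_le.2 h, hgw']
  · intro y hy
    rw [uIcc_of_le (h1'.trans h2')] at hy
    by_cases hyv : y ≤ Γ.layer v
    · simpa [hyv] using hS y ⟨hy.1, hyv⟩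
    · simpa [hyv] using hS' y ⟨(not_le.1 hyv).le, hy.2⟩

/-- Strict monotonicity makes the `y`-coordinate an order isomorphism from the parameter interval to
the range of heights; its inverse is continuous and reparametrises the curve by `y`. -/
theorem Link.of_adj {S : Set V} {u v : V} (h : G.Adj u v) (hu : u ∈ S) (hv : v ∈ S) :
    Γ.Link S u v := by
  have hlt : (Γ.layer u : ℝ) < Γ.layer v := by exact_mod_cast Γ.layer_lt_of_adj h
  have h0 : (Γ.curve h 0).2 = Γ.layer u := by simp
  have h1 : (Γ.curve h 1).2 = Γ.layer v := by simp
  let f : unitInterval → Icc (Γ.layer u : ℝ) (Γ.layer v) := fun t =>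
    ⟨(Γ.curve h t).2, h0.symm.le.trans ((Γ.upward h).monotone t.2.1),
      ((Γ.upward h).monotone t.2.2).trans h1.le⟩
  have hcont : Continuous fun t => (Γ.curve h t).2 := continuous_snd.comp (Γ.curve h).continuous
  have hf : StrictMono f := fun s t hst => Γ.upward h hst
  have hsurj : Function.Surjective f := by
    rintro ⟨y, hy⟩
    have := isPreconnected_univ.intermediate_value (mem_univ (0 : unitInterval))
      (mem_univ 1) hcont.continuousOn
    rw [h0, h1] at this
    obtain ⟨t, -, ht⟩ := this hy
    exact ⟨t, Subtype.ext ht⟩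
  let e := hf.orderIsoOfSurjective f hsurj
  have he : ∀ y, (Γ.curve h (e.symm y)).2 = y := fun y =>
    congrArg Subtype.val (e.apply_symm_apply y)
  have he0 : e.symm ⟨Γ.layer u, left_mem_Icc.2 hlt.le⟩ = 0 := by
    rw [OrderIso.symm_apply_eq]
    exact Subtype.ext h0.symm
  have he1 : e.symm ⟨Γ.layer v, right_mem_Icc.2 hlt.le⟩ = 1 := by
    rw [OrderIso.symm_apply_eq]
    exact Subtype.ext h1.symm
  refine ⟨IccExtend hlt.le fun y => (Γ.curve h (e.symm y)).1, ?_, ?_, ?_, ?_⟩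
  · exact (continuous_fst.comp ((Γ.curve h).continuous.comp e.symm.continuous)).Icc_extend'
  · rw [IccExtend_left, he0]; simp
  · rw [IccExtend_right, he1]; simp
  · intro y hy
    rw [uIcc_of_le hlt.le] at hy
    refine Or.inr ⟨u, v, h, e.symm ⟨y, hy⟩, hu, hv, ?_⟩
    rw [IccExtend_of_mem _ _ hy]
    exact Prod.ext rfl (he ⟨y, hy⟩)

/-- If `b` lies between `a` and `c` on their common layer and `a`, `c` are linked to `v`, then no
link that starts at `b` and avoids these two links reaches the layer of `v`. -/
theorem Link.layer_notMem_of_between {S₁ S₂ S₃ : Set V} {v a b c u : V}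
    (ha : Γ.Link S₁ v a) (hb : Γ.Link S₂ b u) (hc : Γ.Link S₃ v c)
    (hab : Γ.layer a = Γ.layer b) (hcb : Γ.layer c = Γ.layer b)
    (hxa : Γ.x a < Γ.x b) (hxc : Γ.x b < Γ.x c)
    (h₁ : Disjoint S₂ S₁) (h₃ : Disjoint S₂ S₃) :
    Γ.layer v ∉ uIcc (Γ.layer b) (Γ.layer u) := by
  intro hv
  have hv' : (Γ.layer v : ℝ) ∈ uIcc (Γ.layer b : ℝ) (Γ.layer u) := by
    rw [mem_uIcc] at hv ⊢
    exact_mod_cast hv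
  obtain ⟨f, hf, hfv, hfa, hfS⟩ := ha
  obtain ⟨g, hg, hgb, -, hgS⟩ := hb
  obtain ⟨k, hk, hkv, hkc, hkS⟩ := hc
  rw [hab] at hfa hfS
  rw [hcb] at hkc hkS
  have hsub : uIcc (Γ.layer v : ℝ) (Γ.layer b) ⊆ uIcc (Γ.layer b : ℝ) (Γ.layer u) :=
    uIcc_subset_uIcc hv' left_mem_uIcc
  -- At the layer of `v` the outer curves `f` and `k` meet, at the layer of `b` the curve `g` is
  -- strictly between them. Whichever side of `v` it passes, `g` meets `f` or `k`; passing through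
  -- `v` is included.
  rcases le_total (g (Γ.layer v)) (Γ.x v) with h | h
  · obtain ⟨y, hy, hy0⟩ := intermediate_value_uIcc
      (a := (Γ.layer v : ℝ)) (b := Γ.layer b) (hg.sub hf).continuousOn
      (show (0 : ℝ) ∈ _ from mem_uIcc.2 (Or.inl ⟨by simp [hfv, h], by simp [hfa, hgb, hxa.le]⟩))
    have hgf : g y = f y := sub_eq_zero.1 hy0
    exact Set.disjoint_left.1 (disjoint_support h₁) (hgS y (hsub hy)) (hgf ▸ hfS y hy)
  · obtain ⟨y, hy, hy0⟩ := intermediate_value_uIcc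
      (a := (Γ.layer v : ℝ)) (b := Γ.layer b) (hg.sub hk).continuousOn
      (show (0 : ℝ) ∈ _ from mem_uIcc.2 (Or.inr ⟨by simp [hkc, hgb, hxc.le], by simp [hkv, h]⟩))
    have hgk : g y = k y := sub_eq_zero.1 hy0
    exact Set.disjoint_left.1 (disjoint_support h₃) (hgS y (hsub hy)) (hgk ▸ hkS y hy)

end UpwardPlanarLayeredDrawing

/-! ### Leaves of perfect trees -/

namespace OTree

/-- The addresses of the leaves of the perfect `k`-ary tree of height `h`. -/
def LeafAddress (k : ℕ) : ℕ → Type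
  | 0 => Unit
  | h + 1 => Fin k × LeafAddress k h

/-- The number of leaves to the left of a given leaf. -/
def leafIndex (k : ℕ) : (h : ℕ) → LeafAddress k h → ℕ
  | 0, _ => 0
  | h + 1, w => w.1 * k ^ h + leafIndex k h w.2

/-- An address lists the base-`k` digits of the index, the most significant one first. -/
theorem exists_leafIndex_eq (k : ℕ) :
    ∀ (h j : ℕ), j < k ^ h → ∃ w : LeafAddress k h, leafIndex k h w = j
  | 0, j, hj => ⟨(), by simp [leafIndex] at hj ⊢; omega⟩
  | h + 1, j, hj => by
    have hpos : 0 < k ^ h := Nat.pos_of_ne_zero fun h0 => by simp [pow_succ, h0] at hj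
    obtain ⟨w, hw⟩ := exists_leafIndex_eq k h (j % k ^ h) (Nat.mod_lt _ hpos)
    refine ⟨(⟨j / k ^ h, Nat.div_lt_of_lt_mul (by rwa [pow_succ] at hj)⟩, w), ?_⟩
    simp only [leafIndex, hw]
    exact Nat.div_add_mod' j (k ^ h)

/-- The inclusion of the tree that is attached at a leaf of a perfect tree. -/
def leafEmb (out : Bool) (k : ℕ) : (h : ℕ) → (f : ℕ → OTree) → (w : LeafAddress k h) →
    Vertex (f (leafIndex k h w)) → Vertex (perfectWithLeaves out k h f)
  | 0, _, _, v => v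
  | h + 1, f, w, v => .child w.1 (leafEmb out k h (fun j => f (w.1 * k ^ h + j)) w.2 v)

theorem leafEmb_injective (out : Bool) (k : ℕ) : ∀ (h : ℕ) (f : ℕ → OTree) (w : LeafAddress k h),
    Function.Injective (leafEmb out k h f w)
  | 0, _, _ => fun _ _ huv => huv
  | h + 1, f, w => fun u v huv => by
    have : leafEmb out k h (fun j => f (w.1 * k ^ h + j)) w.2 u = leafEmb out k h _ w.2 v := by
      injection huv
    exact leafEmb_injective out k h _ w.2 this

theorem leafEmb_arc (out : Bool) (k : ℕ) : ∀ (h : ℕ) (f : ℕ → OTree) (w : LeafAddress k h)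
    {u v : Vertex (f (leafIndex k h w))}, Arc _ u v →
      Arc _ (leafEmb out k h f w u) (leafEmb out k h f w v)
  | 0, _, _, _, _ => fun huv => huv
  | h + 1, f, w, _, _ => fun huv =>
    Arc.lift (leafEmb_arc out k h (fun j => f (w.1 * k ^ h + j)) w.2 huv)

theorem child_injective {out : Bool} {n : ℕ} {c : Fin n → OTree} (i : Fin n) :
    Function.Injective (Vertex.child i : Vertex (c i) → Vertex (node out n c)) := fun _ _ h => by
  injection h

theorem child_ne_child {out : Bool} {n : ℕ} {c : Fin n → OTree} {i j : Fin n} (hij : i ≠ j)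
    (u : Vertex (c i)) (v : Vertex (c j)) :
    (Vertex.child i u : Vertex (node out n c)) ≠ Vertex.child j v := by
  rintro ⟨⟩
  exact hij rfl

end OTree

/-! ### Embedded rooted trees and monotone curves from root to leaf -/

namespace UpwardPlanarLayeredDrawing

open Set OTree

variable {V : Type*} {G : Digraph V}

/-- The height of `v` over `u` if `out = true`, and of `u` over `v` if `out = false`. -/
def heightOver (Γ : UpwardPlanarLayeredDrawing G) (out : Bool) (u v : V) : ℤ :=
  if out then Γ.layer v - Γ.layer u else Γ.layer u - Γ.layer v

theorem Link.trans_heightOver {Γ : UpwardPlanarLayeredDrawing G} {S : Set V} {u v w : V}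
    {out : Bool} (huv : Γ.Link S u v) (hvw : Γ.Link S v w)
    (h1 : 0 ≤ Γ.heightOver out u v) (h2 : 0 ≤ Γ.heightOver out v w) : Γ.Link S u w := by
  cases out
  · simp only [heightOver, Bool.false_eq_true, if_false, sub_nonneg] at h1 h2
    exact (hvw.symm.trans huv.symm h2 h1).symm
  · simp only [heightOver, if_true, sub_nonneg] at h1 h2
    exact huv.trans hvw h1 h2

/-- An embedding of a rooted tree into a directed graph. -/
structure IsEmbedding (G : Digraph V) {t : OTree} (φ : Vertex t → V) : Prop where
  injective : Function.Injective φ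
  adj : ∀ {u v}, Arc t u v → G.Adj (φ u) (φ v)

theorem IsEmbedding.child {out : Bool} {n : ℕ} {c : Fin n → OTree}
    {φ : Vertex (node out n c) → V} (hφ : IsEmbedding G φ) (i : Fin n) :
    IsEmbedding G fun v : Vertex (c i) => φ (.child i v) :=
  ⟨hφ.injective.comp (child_injective i), fun h => hφ.adj (.lift h)⟩

theorem IsEmbedding.leaf {out : Bool} {k h : ℕ} {f : ℕ → OTree}
    {φ : Vertex (perfectWithLeaves out k h f) → V} (hφ : IsEmbedding G φ) (w : LeafAddress k h) :
    IsEmbedding G fun v => φ (leafEmb out k h f w v) :=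
  ⟨hφ.injective.comp (leafEmb_injective out k h f w), fun h' => hφ.adj (leafEmb_arc out k h f w h')⟩

theorem heightOver_add (Γ : UpwardPlanarLayeredDrawing G) (out : Bool) (u v w : V) :
    Γ.heightOver out u v + Γ.heightOver out v w = Γ.heightOver out u w := by
  cases out <;> simp [heightOver]

theorem heightOver_self (Γ : UpwardPlanarLayeredDrawing G) (out : Bool) (u : V) :
    Γ.heightOver out u u = 0 := by
  cases out <;> simp [heightOver]

/-- Measuring heights in the direction `out` treats sources and sinks alike from here on. -/
theorem IsEmbedding.link_child {Γ : UpwardPlanarLayeredDrawing G} {s : ℤ}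
    (hs : ∀ u v, G.Adj u v → Γ.layer v - Γ.layer u ≤ s) {out : Bool} {n : ℕ} {c : Fin n → OTree}
    {φ : Vertex (node out n c) → V} (hφ : IsEmbedding G φ) (i : Fin n) {S : Set V}
    (h₀ : φ .root ∈ S) (h₁ : φ (.child i .root) ∈ S) :
    Γ.Link S (φ .root) (φ (.child i .root)) ∧
      1 ≤ Γ.heightOver out (φ .root) (φ (.child i .root)) ∧
      Γ.heightOver out (φ .root) (φ (.child i .root)) ≤ s := by
  cases out
  · have hadj := hφ.adj (Arc.toward i)
    have := hs _ _ hadj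
    have := Γ.layer_lt_of_adj hadj
    refine ⟨(Link.of_adj hadj h₁ h₀).symm, ?_⟩
    simp only [heightOver, Bool.false_eq_true, if_false]
    omega
  · have hadj := hφ.adj (Arc.away i)
    have := hs _ _ hadj
    have := Γ.layer_lt_of_adj hadj
    refine ⟨Link.of_adj hadj h₀ h₁, ?_⟩
    simp only [heightOver, if_true]
    omega

/-- The root of an embedded perfect tree is linked to each of its leaves. -/
theorem exists_link_leaf (Γ : UpwardPlanarLayeredDrawing G) {s : ℤ}
    (hs : ∀ u v, G.Adj u v → Γ.layer v - Γ.layer u ≤ s) (out : Bool) (k : ℕ) :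
    ∀ (h : ℕ) (f : ℕ → OTree) (w : LeafAddress k h)
      (φ : Vertex (perfectWithLeaves out k h f) → V), IsEmbedding G φ →
      ∃ S ⊆ range φ, φ .root ∈ S ∧ φ (leafEmb out k h f w .root) ∈ S ∧
        (∀ w', w' ≠ w → ∀ v, φ (leafEmb out k h f w' v) ∉ S) ∧
        Γ.Link S (φ .root) (φ (leafEmb out k h f w .root)) ∧
        h ≤ Γ.heightOver out (φ .root) (φ (leafEmb out k h f w .root)) ∧
        Γ.heightOver out (φ .root) (φ (leafEmb out k h f w .root)) ≤ h * s
  | 0, f, w, φ, _ => by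
    have h0 := Γ.heightOver_self out (φ .root)
    refine ⟨{φ .root}, by simp, rfl, rfl, fun w' hw' => (hw' rfl).elim, Link.refl rfl, ?_, ?_⟩
    · exact h0.symm.le
    · exact h0.le.trans (by simp)
  | h + 1, f, (a, w), φ, hφ => by
    have hφ' : IsEmbedding (t := node out k fun a => perfectWithLeaves out k h
      fun j => f (a * k ^ h + j)) G φ := hφ
    obtain ⟨S, hSφ, hrS, hlS, hS, hlink, h1, h2⟩ := exists_link_leaf Γ hs out k h
      (fun j => f (a * k ^ h + j)) w (fun v => φ (.child a v)) (hφ'.child a)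
    obtain ⟨hlink', h1', h2'⟩ := hφ'.link_child hs a (S := insert (φ .root) S)
      (mem_insert _ _) (mem_insert_of_mem _ hrS)
    have hadd := Γ.heightOver_add out (φ .root) (φ (.child a .root))
      (φ (leafEmb out k (h + 1) f (a, w) .root))
    have hnn : (0 : ℤ) ≤ h := by positivity
    -- The witness is the vertex set of the path from the root to the leaf. It avoids the trees at
    -- all other leaves, whose addresses differ in the first digit or in a later one.
    refine ⟨insert (φ .root) S, ?_, mem_insert _ _, mem_insert_of_mem _ hlS, ?_, ?_, ?_, ?_⟩
    · rintro _ (rfl | h')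
      · exact mem_range_self _
      · obtain ⟨v, hv⟩ := hSφ h'
        exact ⟨_, hv⟩
    · rintro ⟨a', w'⟩ hne v (hv | hv)
      · have := hφ'.injective hv
        injection this
      · by_cases ha : a' = a
        · subst ha
          exact hS w' (fun hw => hne (by rw [hw])) v hv
        · obtain ⟨v', hv'⟩ := hSφ hv
          have := hφ'.injective hv'
          exact child_ne_child (Ne.symm ha) _ _ this
    · exact hlink'.trans_heightOver (hlink.mono (subset_insert _ _)) (by omega) (hnn.trans h1)
    · rw [← hadd]
      push_cast
      exact (add_comm (h : ℤ) 1).le.trans (add_le_add h1' h1)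
    · rw [← hadd]
      push_cast
      rw [add_mul, one_mul, add_comm]
      exact add_le_add h2 h2'

end UpwardPlanarLayeredDrawing

/-! ### The lower bound on the span -/

namespace OTree

theorem exists_alternating_eq_node (out : Bool) {m : ℕ} (hm : 1 ≤ m) :
    ∃ c, alternating out m = node out m c := by
  match m, hm with
  | 1, _ => exact ⟨_, rfl⟩
  | 2, _ => exact ⟨_, rfl⟩
  | n + 3, _ => exact ⟨_, rfl⟩

/-- Oddness of `q` in the case `m = q + 3` is kept because it compensates there for the additional
loss of one. -/
theorem exists_alternating_eq_node_const (out : Bool) {m : ℕ} (hm : 3 ≤ m) :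
    ∃ q, 1 ≤ q ∧ q < m ∧ (m = q + 2 ∨ m = q + 3 ∧ Odd q) ∧
      alternating out m = node out m fun _ => alternating (!out) q := by
  obtain ⟨n, rfl⟩ := Nat.exists_eq_add_of_le' hm
  by_cases h : Odd (n + 3)
  · exact ⟨n + 1, by omega, by omega, by omega, by simp only [alternating, h, if_true]⟩
  · have hn : Odd n := by
      rw [Nat.odd_iff] at h ⊢
      omega
    exact ⟨n, hn.pos, by omega, Or.inr ⟨rfl, hn⟩, by simp only [alternating, h, if_false]⟩

end OTree

/-- Three points with different abscissas can be ordered from left to right. -/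
theorem exists_between_of_two_lt_card {α : Type*} {A : Finset α} (hA : 2 < A.card) {x : α → ℝ}
    (hx : Set.InjOn x A) : ∃ a ∈ A, ∃ b ∈ A, ∃ c ∈ A, x a < x b ∧ x b < x c := by
  obtain ⟨a, ha, b, hb, c, hc, hab, hac, hbc⟩ := Finset.two_lt_card.1 hA
  rcases (hx.ne ha hb hab).lt_or_gt with h1 | h1 <;>
    rcases (hx.ne ha hc hac).lt_or_gt with h2 | h2 <;>
      rcases (hx.ne hb hc hbc).lt_or_gt with h3 | h3
  · exact ⟨a, ha, b, hb, c, hc, h1, h3⟩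
  · exact ⟨a, ha, c, hc, b, hb, h2, h3⟩
  · exact ⟨a, ha, b, hb, c, hc, h1, h3⟩
  · exact ⟨c, hc, a, ha, b, hb, h2, h1⟩
  · exact ⟨b, hb, a, ha, c, hc, h1, h2⟩
  · exact ⟨c, hc, b, hb, a, ha, h3, h1⟩
  · exact ⟨b, hb, c, hc, a, ha, h3, h2⟩
  · exact ⟨c, hc, b, hb, a, ha, h3, h1⟩

namespace UpwardPlanarLayeredDrawing

open Set OTree

variable {V : Type*} {G : Digraph V}

/-- If every tree that is attached at one of `m` leaves of an embedded perfect tree contains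
a vertex at doubled distance at least `q` from its root, linked to it, then some of these leaves
is at doubled distance at least `m` from the root of the perfect tree. -/
theorem exists_leaf_le_heightOver (Γ : UpwardPlanarLayeredDrawing G) {s : ℤ}
    (hs : ∀ u v, G.Adj u v → Γ.layer v - Γ.layer u ≤ s) {out : Bool} {k h m q : ℕ} (hh : 1 ≤ h)
    (hm : m ≤ k ^ h) (hq : m = q + 2 ∨ m = q + 3 ∧ Odd q) {f : ℕ → OTree}
    (hf : ∀ j < m, ∀ ψ : Vertex (f j) → V, IsEmbedding G ψ → ∃ (u : V) (S : Set V),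
      S ⊆ range ψ ∧ Γ.Link S (ψ .root) u ∧ q ≤ 2 * Γ.heightOver (!out) (ψ .root) u)
    {φ : Vertex (perfectWithLeaves out k h f) → V} (hφ : IsEmbedding G φ) :
    ∃ w : LeafAddress k h,
      m ≤ 2 * Γ.heightOver out (φ .root) (φ (leafEmb out k h f w .root)) := by
  by_contra! hlow
  choose w hw using fun j : Fin m => exists_leafIndex_eq k h j (j.2.trans_le hm)
  have hwinj : Function.Injective w := fun i j hij => Fin.ext (by rw [← hw i, ← hw j, hij])
  choose S hSφ _ hbS hS hlink hpos _ using fun j => exists_link_leaf Γ hs out k h f (w j) φ hφ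
  set b : Fin m → V := fun j => φ (leafEmb out k h f (w j) .root)
  replace hbS : ∀ j, b j ∈ S j := hbS
  replace hpos : ∀ j, h ≤ Γ.heightOver out (φ .root) (b j) := hpos
  replace hlow : ∀ j, 2 * Γ.heightOver out (φ .root) (b j) < m := fun j => hlow (w j)
  have hbinj : Function.Injective b := by
    intro i j hij
    by_contra hne
    exact hS j (w i) (hwinj.ne hne) _ (show b i ∈ S j from hij ▸ hbS j)
  -- The possible heights are `1, …, ⌊(m - 1) / 2⌋`, and twice their number is less than `m`.
  obtain ⟨z, -, hz⟩ := Finset.exists_lt_card_fiber_of_mul_lt_card_of_maps_to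
    (s := Finset.univ) (t := Finset.Icc 1 (((m : ℤ) - 1) / 2)) (n := 2)
    (f := fun j => Γ.heightOver out (φ .root) (b j))
    (fun j _ => Finset.mem_Icc.2 ⟨by have := hpos j; omega, by have := hlow j; omega⟩)
    (by simp only [Int.card_Icc, Finset.card_univ, Fintype.card_fin]; omega)
  have hlayer : ∀ i j, Γ.heightOver out (φ .root) (b i) = Γ.heightOver out (φ .root) (b j) →
      Γ.layer (b i) = Γ.layer (b j) := by
    intro i j
    cases out <;> simp [heightOver]
  obtain ⟨i, hi, j, hj, l, hl, hij, hjl⟩ := exists_between_of_two_lt_card hz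
    (x := fun j => Γ.x (b j)) (by
      intro i hi j hj hij
      simp only [Finset.coe_filter, Finset.mem_univ, true_and, mem_ofPred_eq] at hi hj
      exact hbinj (Γ.point_injective
        (Prod.ext hij (congrArg (Int.cast : ℤ → ℝ) (hlayer i j (hi.trans hj.symm))))))
  simp only [Finset.mem_filter, Finset.mem_univ, true_and] at hi hj hl
  -- The middle leaf `b j` is the root of a tree of the opposite kind, whose long curve runs back
  -- towards the root.
  obtain ⟨u, S', hS', hlink', hq'⟩ := hf (leafIndex k h (w j)) (by rw [hw]; exact j.2)
    (fun v => φ (leafEmb out k h f (w j) v)) (hφ.leaf (w j))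
  have hdisj : ∀ i, i ≠ j → Disjoint S' (S i) := by
    intro i hne
    rw [Set.disjoint_left]
    intro v hv
    obtain ⟨v, rfl⟩ := hS' hv
    exact hS i (w j) (fun h => hne (hwinj h).symm) v
  refine Link.layer_notMem_of_between (hlink i) hlink' (hlink l) (hlayer i j (hi.trans hj.symm))
    (hlayer l j (hl.trans hj.symm)) hij hjl (hdisj i ?_) (hdisj l ?_) ?_
  · rintro rfl
    exact lt_irrefl _ hij
  · rintro rfl
    exact lt_irrefl _ hjl
  · have h1 := hlow j
    have h2 := hpos j
    -- If `m = q + 3`, oddness of `q` improves `q ≤ 2 * H` to `q + 1 ≤ 2 * H`, where `H` is the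
    -- height of the curve from `b j`. As twice the height of `b j` over the root is less than `m`,
    -- this curve reaches the layer of the root.
    have h3 : (m : ℤ) ≤ 2 * Γ.heightOver (!out) (b j) u + 2 := by
      rcases hq with rfl | ⟨rfl, r, rfl⟩
      · push_cast; linarith
      · push_cast at hq' ⊢
        have : Γ.heightOver (!out) (b j) u > r := by
          change (2 * r + 1 : ℤ) ≤ 2 * Γ.heightOver (!out) (b j) u at hq'
          omega
        omega
    rw [mem_uIcc]
    have : (1 : ℤ) ≤ h := by exact_mod_cast hh
    cases out
    · simp only [heightOver, Bool.false_eq_true, if_false, Bool.not_false, if_true] at h1 h2 h3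
      change Γ.layer (b j) ≤ _ ∧ _ ∨ _ ∧ _ ≤ Γ.layer (b j)
      omega
    · simp only [heightOver, Bool.false_eq_true, if_false, Bool.not_true, if_true] at h1 h2 h3
      change Γ.layer (b j) ≤ _ ∧ _ ∨ _ ∧ _ ≤ Γ.layer (b j)
      omega

/-- The tree is a variable `t` with an equation, so that it can be rewritten although the type of
`φ` depends on it. For `m ≤ 2` any leaf works, since its height is at least `h ≥ 1`. Containment in
the range of `φ` is what keeps the curve disjoint from those of other branches in the induction. -/
theorem exists_link_le_heightOver (Γ : UpwardPlanarLayeredDrawing G) {s : ℤ}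
    (hs : ∀ u v, G.Adj u v → Γ.layer v - Γ.layer u ≤ s) {k h : ℕ} (hh : 1 ≤ h) (m : ℕ) :
    1 ≤ m → m ≤ k ^ h → ∀ (out : Bool) (t : OTree),
      t = replaceVertices k h (alternating out m) → ∀ φ : Vertex t → V, IsEmbedding G φ →
      ∃ (u : V) (S : Set V), S ⊆ range φ ∧ Γ.Link S (φ .root) u ∧
        m ≤ 2 * Γ.heightOver out (φ .root) u ∧ Γ.heightOver out (φ .root) u ≤ h * s := by
  induction m using Nat.strong_induction_on with
  | _ m ih =>
  intro hm1 hm out t ht φ hφ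
  suffices ∃ f, t = perfectWithLeaves out k h f ∧ (3 ≤ m → ∃ q, 1 ≤ q ∧ q < m ∧
      (m = q + 2 ∨ m = q + 3 ∧ Odd q) ∧
        ∀ j < m, f j = replaceVertices k h (alternating (!out) q)) by
    obtain ⟨f, rfl, hf⟩ := this
    obtain ⟨w, hw⟩ : ∃ w : LeafAddress k h,
        m ≤ 2 * Γ.heightOver out (φ .root) (φ (leafEmb out k h f w .root)) := by
      by_cases hm3 : 3 ≤ m
      · obtain ⟨q, hq1, hqm, hq, hf⟩ := hf hm3
        refine Γ.exists_leaf_le_heightOver hs hh hm hq (fun j hj ψ hψ => ?_) hφ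
        obtain ⟨u, S, h1, h2, h3, -⟩ := ih q hqm hq1 (hqm.le.trans hm) (!out) _ (hf j hj) ψ hψ
        exact ⟨u, S, h1, h2, h3⟩
      · obtain ⟨w, -⟩ := exists_leafIndex_eq k h 0 (by omega)
        obtain ⟨S, -, -, -, -, -, h1, -⟩ := exists_link_leaf Γ hs out k h f w φ hφ
        exact ⟨w, by omega⟩
    obtain ⟨S, h1, -, -, -, h2, -, h3⟩ := exists_link_leaf Γ hs out k h f w φ hφ
    exact ⟨_, S, h1, h2, hw, h3⟩
  by_cases hm3 : 3 ≤ m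
  · obtain ⟨q, hq1, hqm, hq, heq⟩ := exists_alternating_eq_node_const out hm3
    rw [heq] at ht
    exact ⟨_, ht, fun _ => ⟨q, hq1, hqm, hq, fun j hj => by simp [hj]⟩⟩
  · obtain ⟨c, hc⟩ := exists_alternating_eq_node out hm1
    rw [hc] at ht
    exact ⟨_, ht, fun h => (hm3 h).elim⟩

/-- The span of every drawing of the tree obtained from `alternating out m` is at least
`m / (2 * h)`. -/
theorem le_span_mul (out : Bool) {k h m : ℕ} (hh : 1 ≤ h) (hm1 : 1 ≤ m) (hm : m ≤ k ^ h)
    (Γ : UpwardPlanarLayeredDrawing (replaceVertices k h (alternating out m)).toDigraph) {s : ℕ}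
    (hs : Γ.span ≤ s) : m ≤ 2 * h * s := by
  have hs' : ∀ u v, (replaceVertices k h (alternating out m)).toDigraph.Adj u v →
      Γ.layer v - Γ.layer u ≤ (s : ℤ) := by
    intro u v huv
    have : (((Γ.layer v - Γ.layer u).toNat : ℕ) : ℕ∞) ≤ s :=
      
      (le_iSup₂_of_le u v (le_iSup (fun _ => (((Γ.layer v - Γ.layer u).toNat : ℕ) : ℕ∞)) huv)).trans hs
    have := Nat.cast_le.1 this
    omega
  obtain ⟨u, S, -, -, h1, h2⟩ := Γ.exists_link_le_heightOver hs' hh m hm1 hm out _ rfl id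
    ⟨Function.injective_id, fun h => h⟩
  zify
  linarith

end UpwardPlanarLayeredDrawing

/-! ### Rooted trees as directed trees -/

namespace OTree

/-- `IsParent u v`: the vertex `v` is a child of `u`. -/
inductive IsParent : {t : OTree} → Vertex t → Vertex t → Prop where
  | root {out : Bool} {n : ℕ} {c : Fin n → OTree} (i : Fin n) :
      IsParent (t := node out n c) .root (.child i .root)
  | lift {out : Bool} {n : ℕ} {c : Fin n → OTree} {i : Fin n} {u v : Vertex (c i)} :
      IsParent u v → IsParent (t := node out n c) (.child i u) (.child i v)

/-- The distance of a vertex from the root. -/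
def depth : {t : OTree} → Vertex t → ℕ
  | _, .root => 0
  | _, .child _ v => depth v + 1

theorem Arc.isParent {t : OTree} {u v : Vertex t} (h : Arc t u v) :
    IsParent u v ∨ IsParent v u := by
  induction h with
  | away i => exact Or.inl (.root i)
  | toward i => exact Or.inr (.root i)
  | lift _ ih => exact ih.imp .lift .lift

theorem IsParent.arc {t : OTree} {u v : Vertex t} (h : IsParent u v) : Arc t u v ∨ Arc t v u := by
  induction h with
  | @root out n c i =>
    cases out
    · exact Or.inr (.toward i)
    · exact Or.inl (.away i)
  | lift _ ih => exact ih.imp .lift .lift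

theorem IsParent.depth_eq {t : OTree} {u v : Vertex t} (h : IsParent u v) :
    depth v = depth u + 1 := by
  induction h with
  | root i => rfl
  | lift _ ih => simp [depth, ih]

theorem IsParent.ne_root {t : OTree} {u v : Vertex t} (h : IsParent u v) : v ≠ .root := by
  rintro rfl
  nomatch h

theorem IsParent.eq {t : OTree} {u u' v : Vertex t} (h : IsParent u v) (h' : IsParent u' v) :
    u = u' := by
  induction h with
  | root i =>
    cases h' with
    | root => rfl
    | lift h' => exact (h'.ne_root rfl).elim
  | lift h ih =>
    cases h' with
    | root => exact (h.ne_root rfl).elim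
    | lift h' => rw [ih h']

theorem Arc.asymm {t : OTree} {u v : Vertex t} (h : Arc t u v) : ¬ Arc t v u := by
  induction h with
  | away i => intro h'; nomatch h'
  | toward i => intro h'; nomatch h'
  | lift _ ih =>
    intro h'
    cases h' with
    | lift h' => exact ih h'

theorem toSimpleGraphInclusive_adj {t : OTree} {u v : Vertex t} :
    t.toDigraph.toSimpleGraphInclusive.Adj u v ↔ IsParent u v ∨ IsParent v u := by
  simp only [Digraph.toSimpleGraphInclusive, SimpleGraph.fromRel_adj, toDigraph]
  constructor
  · rintro ⟨-, h | h⟩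
    exacts [h.isParent, h.isParent.symm]
  · rintro (h | h)
    · refine ⟨?_, h.arc⟩
      rintro rfl
      simpa using h.depth_eq
    · refine ⟨?_, h.arc.symm⟩
      rintro rfl
      simpa using h.depth_eq

theorem reachable_root {t : OTree} (v : Vertex t) :
    t.toDigraph.toSimpleGraphInclusive.Reachable .root v := by
  induction v with
  | root => exact .refl _
  | @child out n c i v ih =>
    refine (SimpleGraph.Adj.reachable (toSimpleGraphInclusive_adj.2 (Or.inl (.root i)))).trans ?_
    let e : (c i).toDigraph.toSimpleGraphInclusive →g
        (node out n c).toDigraph.toSimpleGraphInclusive :=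
      ⟨.child i, fun h => toSimpleGraphInclusive_adj.2
        ((toSimpleGraphInclusive_adj.1 h).imp .lift .lift)⟩
    exact ih.map e

/-- Each edge is determined by its child endpoint, which is never the root; so a connected graph has
at most one edge fewer than vertices here, as a tree requires. -/
theorem isDirectedTree_toDigraph (t : OTree) : t.toDigraph.IsDirectedTree := by
  refine ⟨fun u v => Arc.asymm, SimpleGraph.isTree_iff_connected_and_card.2 ?_⟩
  have hconn : t.toDigraph.toSimpleGraphInclusive.Connected :=
    { preconnected := fun u v => (reachable_root u).symm.trans (reachable_root v)
      nonempty := ⟨.root⟩ }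
  refine ⟨hconn, le_antisymm ?_ hconn.card_vert_le_card_edgeSet_add_one⟩
  have hedge : ∀ e : t.toDigraph.toSimpleGraphInclusive.edgeSet,
      ∃ (v : {v : Vertex t // v ≠ .root}) (u : Vertex t), IsParent u v.1 ∧ e.1 = s(u, v.1) := by
    rintro ⟨e, he⟩
    induction e with
    | h u v =>
      rcases toSimpleGraphInclusive_adj.1 he with h | h
      · exact ⟨⟨v, h.ne_root⟩, u, h, rfl⟩
      · exact ⟨⟨u, h.ne_root⟩, v, h, Sym2.eq_swap⟩
  choose f g hfg hs using hedge
  have hinj : Function.Injective f := by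
    intro e e' h
    have hg : g e = g e' := (hfg e).eq (h ▸ hfg e')
    exact Subtype.ext (by rw [hs, hs, h, hg])
  have := Fintype.ofFinite (Vertex t)
  classical
  have h1 := Nat.card_le_card_of_injective f hinj
  have h2 : Nat.card {v : Vertex t // v ≠ .root} = Nat.card (Vertex t) - 1 := by
    rw [Nat.card_eq_fintype_card, Nat.card_eq_fintype_card, Fintype.card_subtype_compl,
      Fintype.card_subtype_eq]
  have h3 : 0 < Nat.card (Vertex t) := Nat.card_pos_iff.2 ⟨⟨.root⟩, inferInstance⟩
  omega

/-! ### Degrees -/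

theorem vertexDegree_root (out : Bool) (n : ℕ) (c : Fin n → OTree) :
    (node out n c).toDigraph.vertexDegree .root = n := by
  let f : Fin n → Vertex (node out n c) × Vertex (node out n c) := fun i =>
    if out then (.root, .child i .root) else (.child i .root, .root)
  have hf : Function.Injective f := by
    intro i j hij
    by_contra hne
    cases out
    · exact child_ne_child hne _ _ (congrArg Prod.fst hij)
    · exact child_ne_child hne _ _ (congrArg Prod.snd hij)
  have : {e : Vertex (node out n c) × Vertex (node out n c) |
      (node out n c).toDigraph.Adj e.1 e.2 ∧ (e.1 = .root ∨ e.2 = .root)} = Set.range f := by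
    ext ⟨u, v⟩
    constructor
    · rintro ⟨h, h'⟩
      change Arc _ u v at h
      cases h with
      | away i => exact ⟨i, rfl⟩
      | toward i => exact ⟨i, rfl⟩
      | lift h => simp at h'
    · rintro ⟨i, hi⟩
      cases out
      · cases hi
        exact ⟨.toward i, Or.inr rfl⟩
      · cases hi
        exact ⟨.away i, Or.inl rfl⟩
  rw [Digraph.vertexDegree, this, ← Set.image_univ, Set.ncard_image_of_injective _ hf]
  simp

/-- The only arc that a vertex can gain in the larger tree is the one from a subtree's root to its
parent. -/
theorem vertexDegree_child {out : Bool} {n : ℕ} {c : Fin n → OTree} (i : Fin n)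
    (v : Vertex (c i)) [Decidable (v = .root)] :
    (node out n c).toDigraph.vertexDegree (.child i v) =
      (c i).toDigraph.vertexDegree v + if v = .root then 1 else 0 := by
  let f : Vertex (c i) × Vertex (c i) → Vertex (node out n c) × Vertex (node out n c) :=
    Prod.map (.child i) (.child i)
  have hf : Function.Injective f := (child_injective i).prodMap (child_injective i)
  let a : Vertex (node out n c) × Vertex (node out n c) :=
    if out then (.root, .child i .root) else (.child i .root, .root)
  let A := {e : Vertex (c i) × Vertex (c i) | (c i).toDigraph.Adj e.1 e.2 ∧ (e.1 = v ∨ e.2 = v)}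
  have ha : a ∉ f '' A := by
    rintro ⟨e, -, he⟩
    cases out
    · nomatch congrArg Prod.snd he
    · nomatch congrArg Prod.fst he
  have key : {e : Vertex (node out n c) × Vertex (node out n c) |
      (node out n c).toDigraph.Adj e.1 e.2 ∧ (e.1 = .child i v ∨ e.2 = .child i v)} =
      if v = .root then insert a (f '' A) else f '' A := by
    have hmem : ∀ e, e ∈ (if v = .root then insert a (f '' A) else f '' A) ↔
        (v = .root ∧ e = a) ∨ e ∈ f '' A := by
      intro e
      split_ifs with h <;> simp [h]
    ext ⟨u, w⟩
    rw [hmem]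
    constructor
    · rintro ⟨h, h'⟩
      change Arc _ u w at h
      cases h with
      | away j =>
        rcases h' with h' | h'
        · nomatch h'
        · cases h'
          exact Or.inl ⟨rfl, rfl⟩
      | toward j =>
        rcases h' with h' | h'
        · cases h'
          exact Or.inl ⟨rfl, rfl⟩
        · nomatch h'
      | @lift _ _ _ j u w h =>
        by_cases hij : j = i
        · subst hij
          exact Or.inr ⟨(u, w), ⟨h, h'.imp (fun h => child_injective _ h)
            (fun h => child_injective _ h)⟩, rfl⟩
        · rcases h' with h' | h'
          · exact (child_ne_child hij _ _ h').elim
          · exact (child_ne_child hij _ _ h').elim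
    · rintro (⟨rfl, h⟩ | ⟨⟨u', w'⟩, ⟨h, h'⟩, he⟩)
      · cases out
        · obtain ⟨rfl, rfl⟩ := Prod.mk.inj (h : (u, w) = (.child i .root, .root))
          exact ⟨.toward i, Or.inl rfl⟩
        · obtain ⟨rfl, rfl⟩ := Prod.mk.inj (h : (u, w) = (.root, .child i .root))
          exact ⟨.away i, Or.inr rfl⟩
      · cases he
        exact ⟨.lift h, h'.imp (congrArg _) (congrArg _)⟩
  rw [Digraph.vertexDegree, key]
  split_ifs
  · rw [Set.ncard_insert_of_notMem ha, Set.ncard_image_of_injective _ hf]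
    rfl
  · rw [Set.ncard_image_of_injective _ hf]
    rfl

/-- All degrees are at most `k + 1`, and the degree of the root is at most `k`. -/
def DegreeBound (k : ℕ) (t : OTree) : Prop :=
  t.toDigraph.vertexDegree .root ≤ k ∧ ∀ v, t.toDigraph.vertexDegree v ≤ k + 1

theorem DegreeBound.node {k : ℕ} {out : Bool} {n : ℕ} {c : Fin n → OTree} (hn : n ≤ k)
    (hc : ∀ i, DegreeBound k (c i)) : DegreeBound k (node out n c) := by
  classical
  have hroot : (OTree.node out n c).toDigraph.vertexDegree .root ≤ k := by
    rwa [vertexDegree_root]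
  refine ⟨hroot, fun v => ?_⟩
  cases v with
  | root => omega
  | child i v =>
    rw [vertexDegree_child]
    split_ifs with h
    · subst h
      exact Nat.succ_le_succ (hc i).1
    · exact (hc i).2 v

theorem DegreeBound.perfectWithLeaves {k : ℕ} (out : Bool) : ∀ (h : ℕ) (f : ℕ → OTree),
    (∀ j, DegreeBound k (f j)) → DegreeBound k (perfectWithLeaves out k h f)
  | 0, _, hf => hf 0
  | h + 1, _, hf => DegreeBound.node le_rfl fun _ =>
    DegreeBound.perfectWithLeaves out h _ fun _ => hf _

theorem degreeBound_replaceVertices (k h : ℕ) (t : OTree) :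
    DegreeBound k (replaceVertices k h t) := by
  induction t with
  | node out n c ih =>
    refine DegreeBound.perfectWithLeaves out h _ fun j => ?_
    split_ifs with hj
    · exact ih _
    · exact DegreeBound.node (Nat.zero_le _) fun i => i.elim0

theorem vertexDegree_root_replaceVertices (k h : ℕ) (t : OTree) :
    (replaceVertices k (h + 1) t).toDigraph.vertexDegree .root = k := by
  cases t with
  | node out n c => exact vertexDegree_root out k _

theorem isGreatest_vertexDegree {k h : ℕ} (hk : 0 < k) (out : Bool) {n : ℕ} (hn : 0 < n)
    (c : Fin n → OTree) :
    IsGreatest (Set.range (replaceVertices k (h + 1) (node out n c)).toDigraph.vertexDegree)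
      (k + 1) := by
  classical
  refine ⟨?_, ?_⟩
  · let f : ℕ → OTree := fun j =>
      if hj : j < n then replaceVertices k (h + 1) (c ⟨j, hj⟩) else single out
    let c' : Fin k → OTree := fun a => perfectWithLeaves out k h fun j => f (a * k ^ h + j)
    -- The leftmost child of the root attains the maximum, with `k` children and one parent. If the
    -- perfect tree has height one, this child is a merged leaf and its children belong to the next
    -- perfect tree.
    have hc' : (c' ⟨0, hk⟩).toDigraph.vertexDegree .root = k := by
      cases h with
      | zero =>
        have : c' ⟨0, hk⟩ = replaceVertices k 1 (c ⟨0, hn⟩) := by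
          simp [c', f, perfectWithLeaves, hn]
        rw [this]
        exact vertexDegree_root_replaceVertices k 0 _
      | succ h => exact vertexDegree_root out k _
    refine ⟨(.child ⟨0, hk⟩ .root : Vertex (node out k c')), ?_⟩
    have := vertexDegree_child (out := out) (c := c') ⟨0, hk⟩ .root
    rwa [if_pos rfl, hc'] at this
  · rintro _ ⟨v, rfl⟩
    exact (degreeBound_replaceVertices k (h + 1) _).2 v

/-! ### Directed paths -/

/-- The tree has a rank function with values at most `b` that increases by one along every arc and
has the value `a` at the root. -/
def HasRank (b : ℕ) (t : OTree) (a : ℕ) : Prop :=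
  ∃ ρ : Vertex t → ℕ, ρ .root = a ∧ (∀ v, ρ v ≤ b) ∧ ∀ u v, Arc t u v → ρ v = ρ u + 1

theorem HasRank.node {b a a' : ℕ} {out : Bool} {n : ℕ} {c : Fin n → OTree}
    (hc : ∀ i, HasRank b (c i) a) (ha' : a' ≤ b) (h : if out then a = a' + 1 else a' = a + 1) :
    HasRank b (node out n c) a' := by
  choose ρ hroot hb hρ using hc
  let r : Vertex (OTree.node out n c) → ℕ := fun v =>
    match v with
    | .root => a'
    | .child i v => ρ i v
  refine ⟨r, rfl, ?_, ?_⟩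
  · intro v
    cases v with
    | root => exact ha'
    | child i v => exact hb i v
  · intro u v huv
    cases huv with
    | away i => simpa [r, hroot] using h
    | toward i => simpa [r, hroot] using h
    | lift huv => exact hρ _ _ _ huv

theorem HasRank.single {b a : ℕ} (out : Bool) (ha : a ≤ b) : HasRank b (single out) a :=
  ⟨fun _ => a, rfl, fun _ => ha, fun u v huv => by
    cases huv with
    | away i => exact i.elim0
    | toward i => exact i.elim0
    | @lift _ _ _ i => exact i.elim0⟩

/-- Leaves get the extreme rank in the direction of the arcs, `b` or `0`, and the root is `h` steps
away from it. The assumption `h ≤ b` keeps the subtraction exact. -/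
theorem HasRank.perfectWithLeaves {b : ℕ} (out : Bool) (k : ℕ) : ∀ (h : ℕ) (f : ℕ → OTree), h ≤ b →
    (∀ j, HasRank b (f j) (if out then b else 0)) →
      HasRank b (perfectWithLeaves out k h f) (if out then b - h else h)
  | 0, _, _, hf => hf 0
  | h + 1, f, hb, hf => by
    refine HasRank.node (a := if out then b - h else h)
      (fun _ => HasRank.perfectWithLeaves out k h _ (by omega) fun _ => hf _) ?_ ?_
    · cases out <;> grind
    · cases out <;> grind

/-- Sources and sinks alternate, starting with a source if `out = true`. -/
inductive Alternates : Bool → OTree → Prop where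
  | node {out : Bool} {n : ℕ} {c : Fin n → OTree} :
      (∀ i, Alternates (!out) (c i)) → Alternates out (node out n c)

theorem alternates_single (out : Bool) : Alternates out (single out) := .node fun i => i.elim0

theorem alternates_alternating (m : ℕ) : ∀ out, Alternates out (alternating out m) := by
  induction m using Nat.strong_induction_on with
  | _ m ih =>
  intro out
  match m with
  | 0 => simpa only [alternating] using alternates_single out
  | 1 => simpa only [alternating] using .node fun _ => alternates_single _
  | 2 => simpa only [alternating] using .node fun _ => alternates_single _
  | n + 3 =>
    rw [alternating]
    refine .node fun _ => ?_
    split_ifs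
    · exact ih _ (by omega) _
    · exact ih _ (by omega) _

/-- Sources of the original tree get rank `0` and sinks rank `h`. Every perfect tree joins these two
values exactly, so the ranks agree at merged vertices. -/
theorem Alternates.hasRank {k h : ℕ} {out : Bool} {t : OTree} (ht : Alternates out t) :
    HasRank h (replaceVertices k h t) (if out then 0 else h) := by
  induction ht with
  | @node out n c _ ih =>
    have := HasRank.perfectWithLeaves (b := h) out k h (fun j =>
      if hj : j < n then replaceVertices k h (c ⟨j, hj⟩) else OTree.single out) le_rfl (by
        intro j
        by_cases hj : j < n
        · have := ih ⟨j, hj⟩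
          cases out <;> simpa [hj] using this
        · rw [dif_neg hj]
          exact HasRank.single _ (by split_ifs <;> omega))
    rwa [Nat.sub_self] at this

theorem HasRank.length_le {b a : ℕ} {t : OTree} (ht : HasRank b t a) {m : ℕ}
    {p : Fin (m + 1) → Vertex t} (hp : t.toDigraph.IsDirectedPath p) : m ≤ b := by
  obtain ⟨ρ, -, hb, hρ⟩ := ht
  have key : ∀ (i : ℕ) (hi : i < m + 1), i ≤ ρ (p ⟨i, hi⟩) := by
    intro i
    induction i with
    | zero => exact fun _ => Nat.zero_le _
    | succ i ih =>
      intro hi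
      have := hρ _ _ (hp.2 ⟨i, by omega⟩)
      have h2 := ih (by omega)
      exact (Nat.succ_le_succ h2).trans this.symm.le
  exact (key m (Nat.lt_succ_self m)).trans (hb _)

end OTree

/-! ### An upward-planar layered drawing of a rooted tree -/

namespace OTree

/-- A bound for the heights of the vertices in the drawing of a rooted tree. -/
def extent : OTree → ℤ
  | node _ n c => (n + 1) * (2 * ∑ i, extent (c i) + 1)

/-- The `y`-coordinates of the drawing. The subtrees of the children of the root lie in disjoint
horizontal strips, above the root or below it. -/
def height : {t : OTree} → Vertex t → ℤ
  | _, .root => 0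
  | _, .child (out := out) (c := c) i v =>
    (if out then 1 else -1) * ((i + 1) * (2 * ∑ j, extent (c j) + 1)) + height v

theorem extent_nonneg (t : OTree) : 0 ≤ extent t := by
  induction t with
  | node out n c ih =>
    have := Finset.sum_nonneg fun i (_ : i ∈ Finset.univ) => ih i
    rw [extent]
    positivity

theorem extent_le_sum {n : ℕ} (c : Fin n → OTree) (i : Fin n) :
    extent (c i) ≤ ∑ j, extent (c j) :=
  Finset.single_le_sum (f := fun j => extent (c j)) (fun j _ => extent_nonneg (c j))
    (Finset.mem_univ i)

/-- The farthest strip is centred at distance `n * (2 * C + 1)`, and its subtree deviates from the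
centre by at most `C`, the sum of the extents. -/
theorem abs_height_le {t : OTree} (v : Vertex t) : |height v| ≤ extent t := by
  induction v with
  | root => simpa [height] using extent_nonneg _
  | @child out n c i v ih =>
    have h1 := extent_le_sum c i
    have h2 := extent_nonneg (c i)
    rw [height, extent]
    set C := ∑ j, extent (c j)
    have h3 : ((i : ℤ) + 1) * (2 * C + 1) ≤ n * (2 * C + 1) := by
      have : ((i : ℤ) + 1) ≤ n := by exact_mod_cast i.2
      gcongr
      linarith
    have h4 : 0 ≤ ((i : ℤ) + 1) * (2 * C + 1) :=
      mul_nonneg (by positivity) (by linarith)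
    rw [abs_le] at ih ⊢
    split_ifs <;> constructor <;> linarith

theorem height_child_pos {out : Bool} {n : ℕ} {c : Fin n → OTree} (i : Fin n) (v : Vertex (c i)) :
    0 < (if out then 1 else -1) * height (.child i v : Vertex (node out n c)) := by
  have h1 := extent_le_sum c i
  have h2 := abs_le.1 (abs_height_le v)
  have h3 := extent_nonneg (c i)
  rw [height]
  set C := ∑ j, extent (c j)
  have h4 : 2 * C + 1 ≤ ((i : ℤ) + 1) * (2 * C + 1) :=
    le_mul_of_one_le_left (by linarith) (by simp)
  split_ifs <;> linarith

/-- Strip centres are at least `2 * C + 1` apart, and each subtree deviates by at most `C`. -/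
theorem height_child_lt {out : Bool} {n : ℕ} {c : Fin n → OTree} {i j : Fin n} (hij : i < j)
    (u : Vertex (c i)) (v : Vertex (c j)) :
    (if out then 1 else -1) * height (.child i u : Vertex (node out n c)) <
      (if out then 1 else -1) * height (.child j v : Vertex (node out n c)) := by
  have h1 := extent_le_sum c i
  have h2 := abs_le.1 (abs_height_le u)
  have h3 := extent_nonneg (c i)
  have h1' := extent_le_sum c j
  have h2' := abs_le.1 (abs_height_le v)
  rw [height, height]
  set C := ∑ j, extent (c j)
  have h4 : ((i : ℤ) + 1 + 1) * (2 * C + 1) ≤ ((j : ℤ) + 1) * (2 * C + 1) := by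
    have : (i : ℤ) + 1 ≤ j := by exact_mod_cast hij
    gcongr
    linarith
  split_ifs <;> linarith

theorem height_injective (t : OTree) : Function.Injective (height : Vertex t → ℤ) := by
  have hroot : ∀ {out n} {c : Fin n → OTree} (i : Fin n) (v : Vertex (c i)),
      height (.child i v : Vertex (node out n c)) ≠ 0 := by
    intro out n c i v h
    have := height_child_pos (out := out) i v
    rw [h, mul_zero] at this
    exact lt_irrefl _ this
  intro u
  induction u with
  | root =>
    intro v h
    cases v with
    | root => rfl
    | child i v => exact (hroot i v h.symm).elim
  | @child out n c i u ih =>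
    intro v h
    cases v with
    | root => exact (hroot i u h).elim
    | child j v =>
      rcases lt_trichotomy i j with hij | rfl | hij
      · exact ((height_child_lt (out := out) hij u v).ne (by rw [h])).elim
      · rw [height, height] at h
        rw [ih (add_left_cancel h)]
      · exact ((height_child_lt (out := out) hij v u).ne (by rw [h])).elim

theorem Arc.height_lt {t : OTree} {u v : Vertex t} (h : Arc t u v) : height u < height v := by
  induction h with
  | @away n c i => simpa [height] using height_child_pos (out := true) (c := c) i .root
  | @toward n c i => simpa [height] using height_child_pos (out := false) (c := c) i .root
  | lift _ ih => exact (add_lt_add_iff_left _).2 ih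

/-- Edges between the same two levels of the tree appear in the same order on both levels. -/
theorem IsParent.height_order {t : OTree} {p c p' c' : Vertex t} (h : IsParent p c)
    (h' : IsParent p' c') (hd : depth p = depth p') :
    p = p' ∨ height p < height p' ∧ height c < height c' ∨
      height p' < height p ∧ height c' < height c := by
  induction h with
  | root i =>
    cases h' with
    | root j => exact Or.inl rfl
    | lift h' => simp [depth] at hd
  | @lift out n f i p c h ih =>
    cases h' with
    | root j => simp [depth] at hd
    | @lift _ _ _ j p' c' h' =>
      -- Once the branches to `p` and `p'` separate, their entire subtrees lie in ordered strips, so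
      -- parents and children compare in the same way.
      have key : ∀ {i j : Fin n} (p c : Vertex (f i)) (p' c' : Vertex (f j)), i < j →
          (height (.child i p : Vertex (node out n f)) <
              height (.child j p' : Vertex (node out n f)) ∧
            height (.child i c : Vertex (node out n f)) <
              height (.child j c' : Vertex (node out n f))) ∨
          (height (.child j p' : Vertex (node out n f)) <
              height (.child i p : Vertex (node out n f)) ∧
            height (.child j c' : Vertex (node out n f)) <
              height (.child i c : Vertex (node out n f))) := by
        intro i j p c p' c' hij
        have h1 := height_child_lt (out := out) hij p p'
        have h2 := height_child_lt (out := out) hij c c'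
        cases out
        · simp only [Bool.false_eq_true, if_false] at h1 h2
          right
          constructor <;> linarith
        · simp only [if_true] at h1 h2
          left
          constructor <;> linarith
      rcases lt_trichotomy i j with hij | rfl | hij
      · exact Or.inr (key p c p' c' hij)
      · rcases ih h' (by simpa [depth] using hd) with rfl | h2 | h2
        · exact Or.inl rfl
        · exact Or.inr (Or.inl (by simpa [height] using h2))
        · exact Or.inr (Or.inr (by simpa [height] using h2))
      · exact Or.inr (key p' c' p c hij).symm

/-- The position of a vertex in the drawing. -/
def position {t : OTree} (v : Vertex t) : ℝ × ℝ := ((depth v : ℝ), ((height v : ℤ) : ℝ))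

theorem position_injective (t : OTree) : Function.Injective (position : Vertex t → ℝ × ℝ) :=
  fun _ _ h => height_injective t (Int.cast_injective (congrArg Prod.snd h))

theorem IsParent.segment_apply {t : OTree} {p c : Vertex t} (h : IsParent p c)
    (s : unitInterval) :
    Path.segment (position p) (position c) s =
      (depth p + (s : ℝ), (1 - (s : ℝ)) * height p + s * height c) := by
  rw [Path.segment_apply, AffineMap.lineMap_apply_module]
  refine Prod.ext ?_ ?_
  · simp only [position, Prod.fst_add, Prod.smul_fst, smul_eq_mul, h.depth_eq]
    push_cast
    ring
  · simp [position]

theorem IsParent.eq_or_eq_of_segment_eq_position {t : OTree} {p c w : Vertex t}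
    (h : IsParent p c) {s : unitInterval}
    (hs : Path.segment (position p) (position c) s = position w) : w = p ∨ w = c := by
  have h1 : (depth p : ℝ) + s = depth w := by
    rw [h.segment_apply] at hs
    exact congrArg Prod.fst hs
  have h2 : depth p ≤ depth w := by
    have : (depth p : ℝ) ≤ depth w := by linarith [s.2.1]
    exact_mod_cast this
  have h3 : depth w ≤ depth p + 1 := by
    have : (depth w : ℝ) ≤ depth p + 1 := by linarith [s.2.2]
    exact_mod_cast this
  obtain h4 | h4 : depth w = depth p ∨ depth w = depth p + 1 := by omega
  · have : s = 0 := Subtype.ext (by rw [h4] at h1; simpa using h1)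
    rw [this, Path.source] at hs
    exact Or.inl (position_injective t hs.symm)
  · have : s = 1 := Subtype.ext (by rw [h4] at h1; push_cast at h1; simpa using h1)
    rw [this, Path.target] at hs
    exact Or.inr (position_injective t hs.symm)

/-- A meeting point inside an edge forces equal parent depths and hence equal parameters. Equal
convex combinations contradict a common strict order at both ends, so the parents coincide, and then
so do the children. -/
theorem IsParent.segment_inter {t : OTree} {p c p' c' : Vertex t} (h : IsParent p c)
    (h' : IsParent p' c') {s s' : unitInterval}
    (hs : Path.segment (position p) (position c) s = Path.segment (position p') (position c') s') :
    (p = p' ∧ c = c') ∨ ∃ w, (w = p ∨ w = c) ∧ (w = p' ∨ w = c') ∧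
      Path.segment (position p) (position c) s = position w := by
  have end' : ∀ w, Path.segment (position p) (position c) s = position w →
      ∃ w, (w = p ∨ w = c) ∧ (w = p' ∨ w = c') ∧
        Path.segment (position p) (position c) s = position w := fun w hw =>
    ⟨w, h.eq_or_eq_of_segment_eq_position hw, h'.eq_or_eq_of_segment_eq_position (hs ▸ hw), hw⟩
  have hs2 := hs
  rw [h.segment_apply, h'.segment_apply, Prod.mk.injEq] at hs2
  obtain ⟨h1, h2⟩ := hs2
  rcases s.2.1.eq_or_lt with h0 | h0
  · exact Or.inr (end' p (by rw [show s = 0 from Subtype.ext h0.symm, Path.source]))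
  rcases s.2.2.eq_or_lt with h0' | h0'
  · exact Or.inr (end' c (by rw [show s = 1 from Subtype.ext h0', Path.target]))
  have hd : depth p = depth p' := by
    have h3 : (depth p : ℝ) < depth p' + 1 := by linarith [s'.2.2]
    have h4 : (depth p' : ℝ) < depth p + 1 := by linarith [s'.2.1]
    have h3' : depth p < depth p' + 1 := by exact_mod_cast h3
    have h4' : depth p' < depth p + 1 := by exact_mod_cast h4
    omega
  rw [hd, add_right_inj] at h1
  rw [← h1] at h2
  have hlt : ∀ {a b a' b' : ℤ}, a < a' → b < b' →
      (1 - (s : ℝ)) * a + s * b < (1 - (s : ℝ)) * a' + s * b' := by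
    intro a b a' b' ha hb
    have ha' : (a : ℝ) < a' := by exact_mod_cast ha
    have hb' : (b : ℝ) < b' := by exact_mod_cast hb
    exact add_lt_add (mul_lt_mul_of_pos_left ha' (by linarith)) (mul_lt_mul_of_pos_left hb' h0)
  rcases h.height_order h' hd with rfl | ⟨h3, h4⟩ | ⟨h3, h4⟩
  · have : (height c : ℝ) = height c' := mul_left_cancel₀ h0.ne' (add_left_cancel h2)
    exact Or.inl ⟨rfl, height_injective t (by exact_mod_cast this)⟩
  · exact ((hlt h3 h4).ne h2).elim
  · exact ((hlt h3 h4).ne h2.symm).elim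

/-- Curves run from tail to head, but the crossing analysis needs segments from parent to child,
along which the abscissa grows. -/
theorem Arc.exists_isParent {t : OTree} {u v : Vertex t} (h : Arc t u v) :
    ∃ p c, IsParent p c ∧ (p = u ∧ c = v ∨ p = v ∧ c = u) ∧ ∀ s : unitInterval,
      ∃ s', Path.segment (position u) (position v) s = Path.segment (position p) (position c) s' := by
  rcases h.isParent with h | h
  · exact ⟨u, v, h, Or.inl ⟨rfl, rfl⟩, fun s => ⟨s, rfl⟩⟩
  · refine ⟨v, u, h, Or.inr ⟨rfl, rfl⟩, fun s => ⟨unitInterval.symm s, ?_⟩⟩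
    rw [← Path.segment_symm, Path.symm_apply, Function.comp_apply]

/-- The straight-line drawing in which the `x`-coordinate is the distance from the root. -/
noncomputable def drawing (t : OTree) : UpwardPlanarLayeredDrawing t.toDigraph where
  x v := depth v
  layer := height
  point_injective := position_injective t
  curve {u v} _ := Path.segment (position u) (position v)
  upward {u v} h := by
    intro s s' hs
    have hlt : (height u : ℝ) < height v := by exact_mod_cast Arc.height_lt h
    have hs' : (s : ℝ) < s' := hs
    simp only [Path.segment_apply, AffineMap.lineMap_apply_module, position, Prod.snd_add,
      Prod.smul_snd, smul_eq_mul]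
    nlinarith
  noncrossing {u v u' v'} h h' hne s s' hs := by
    obtain ⟨p, c, hpc, huv, hseg⟩ := Arc.exists_isParent h
    obtain ⟨p', c', hpc', huv', hseg'⟩ := Arc.exists_isParent h'
    obtain ⟨r, hr⟩ := hseg s
    obtain ⟨r', hr'⟩ := hseg' s'
    rcases hpc.segment_inter hpc' (hr.symm.trans (hs.trans hr')) with ⟨h1, h2⟩ | ⟨w, h1, h2, h3⟩
    · subst h1 h2
      exfalso
      rcases huv with ⟨rfl, rfl⟩ | ⟨rfl, rfl⟩ <;> rcases huv' with ⟨rfl, rfl⟩ | ⟨rfl, rfl⟩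
      exacts [hne rfl, Arc.asymm h h', Arc.asymm h h', hne rfl]
    · refine ⟨w, ?_, ?_, hr.trans h3⟩
      · rcases huv with ⟨rfl, rfl⟩ | ⟨rfl, rfl⟩
        exacts [h1, h1.symm]
      · rcases huv' with ⟨rfl, rfl⟩ | ⟨rfl, rfl⟩
        exacts [h2, h2.symm]
  avoids_vertices {u v} h w s hs := by
    obtain ⟨p, c, hpc, huv, hseg⟩ := Arc.exists_isParent h
    obtain ⟨r, hr⟩ := hseg s
    have := hpc.eq_or_eq_of_segment_eq_position (hr.symm.trans hs)
    rcases huv with ⟨rfl, rfl⟩ | ⟨rfl, rfl⟩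
    exacts [this, this.symm]

end OTree

/-! ### Finiteness of the span and the main theorem -/

theorem UpwardPlanarLayeredDrawing.span_ne_top {V : Type*} [Finite V] {G : Digraph V}
    (Γ : UpwardPlanarLayeredDrawing G) : Γ.span ≠ ⊤ := by
  obtain ⟨b, hb⟩ := (Set.finite_range fun p : V × V =>
    (Γ.layer p.2 - Γ.layer p.1).toNat).bddAbove
  refine ne_top_of_le_ne_top (ENat.natCast_ne_top b) (iSup₂_le fun u v => iSup_le fun _ => ?_)
  exact Nat.cast_le.2 (hb ⟨(u, v), rfl⟩)

theorem OTree.exists_span_eq (t : OTree) : ∃ s : ℕ, t.toDigraph.span = s := by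
  have : t.toDigraph.span ≠ ⊤ := ne_top_of_le_ne_top t.drawing.span_ne_top (iInf_le _ _)
  exact ⟨_, (ENat.natCast_toNat this).symm⟩

theorem mainTheorem12 (d ℓ : ℕ) (hd : 2 < d) (hℓ : 1 ≤ ℓ) (rootIsSource : Bool) :
    let T := (OTree.replaceVertices (d - 1) ℓ
      (OTree.alternating rootIsSource ((d - 1) ^ ℓ))).toDigraph
    T.IsDirectedTree ∧
    IsGreatest (Set.range T.vertexDegree) d ∧
    (∀ (m : ℕ) (p : Fin (m + 1) → _), T.IsDirectedPath p → m ≤ ℓ) ∧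
    ∃ s : ℕ, T.span = s ∧ ((d : ℝ) - 1) ^ ℓ / (2 * ℓ) ≤ s := by
  have hpos : 1 ≤ (d - 1) ^ ℓ := Nat.one_le_pow _ _ (by omega)
  refine ⟨OTree.isDirectedTree_toDigraph _, ?_, fun m p hp =>
    (OTree.alternates_alternating _ rootIsSource).hasRank.length_le hp, ?_⟩
  · obtain ⟨c, hc⟩ := OTree.exists_alternating_eq_node rootIsSource hpos
    obtain ⟨h, rfl⟩ := Nat.exists_eq_add_of_le' hℓ
    have := OTree.isGreatest_vertexDegree (k := d - 1) (h := h) (by omega) rootIsSource hpos c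
    rwa [← hc, Nat.sub_add_cancel (by omega)] at this
  · obtain ⟨s, hs⟩ := OTree.exists_span_eq
      (OTree.replaceVertices (d - 1) ℓ (OTree.alternating rootIsSource ((d - 1) ^ ℓ)))
    refine ⟨s, hs, ?_⟩
    have hℓ' : (0 : ℝ) < ℓ := by exact_mod_cast hℓ
    have hcast : ((d : ℝ) - 1) ^ ℓ = (((d - 1) ^ ℓ : ℕ) : ℝ) := by
      rw [Nat.cast_pow, Nat.cast_sub (by omega), Nat.cast_one]
    -- Rounding up turns the real bound into an element of `ℕ∞`, which can be compared with the
    -- infimum over all drawings.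
    have hle : ((⌈((d : ℝ) - 1) ^ ℓ / (2 * ℓ)⌉₊ : ℕ) : ℕ∞) ≤ s := by
      rw [← hs]
      refine le_iInf fun Γ => ?_
      obtain ⟨n, hn⟩ := ENat.ne_top_iff_exists.1 Γ.span_ne_top
      rw [← hn, Nat.cast_le, Nat.ceil_le, div_le_iff₀ (by positivity), hcast]
      have := UpwardPlanarLayeredDrawing.le_span_mul rootIsSource hℓ hpos le_rfl Γ hn.symm.le
      rw [mul_comm]
      exact_mod_cast this
    exact (Nat.le_ceil _).trans (by exact_mod_cast hle)
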